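/- Let $\mathbb k$ be a field. A variety is an integral separated scheme of finite type over $\mathbb k$ (not necessarily geometrically integral), and morphisms and rational maps are over $\mathbb k$. Let $\mathrm{Burn}_*(\mathbb k)$ be the free abelian group on birational isomorphism classes $[X]$ of $\mathbb k$-varieties, with the bilinear product $[X]\cdot[Y]=\sum_i [Z_i]$, where the $Z_i$ are the irreducible components of $(X\times_{\mathbb k}Y)_{\mathrm{red}}$; this sum is also denoted $[X\times Y]$. Varieties and prime divisors carry their reduced structure. For a birational map $\phi\colon X_1\dashrightarrow X_2$ let $\mathrm{ExDiv}(\phi)$ be the (finite) set of prime divisors of $X_1$ at whose generic point $\phi$ is not a local isomorphism, and put $$c(\phi)=\sum_{E\in \mathrm{ExDiv}(\phi^{-1})}[E]-\sum_{D\in \mathrm{ExDiv}(\phi)}[D]\in \mathrm{Burn}_*(\mathbb k).$$ For dominant morphisms $\pi_i\colon X_i\to B_i$ of varieties ($i=1,2$), let $\mathrm{Bir}(\pi_1,\pi_2)$ be the set of birational maps $\phi\colon X_1\dashrightarrow X_2$ for which there is a (necessarily unique) birational map $\sigma\colon B_1\dashrightarrow B_2$ with $\pi_2\circ\phi=\sigma\circ\pi_1$.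 The vertical motivic invariant of such a $\phi$ is $$c_{\mathrm{ver}}(\phi)=\sum_{\substack{E\in \mathrm{ExDiv}(\phi^{-1})\\ \overline{\pi_2(E)}\ne B_2}}[E]-\sum_{\substack{D\in \mathrm{ExDiv}(\phi)\\ \overline{\pi_1(D)}\ne B_1}}[D].$$ A flat morphism $\pi\colon X\to B$ of normal varieties is called birationally trivial in codimension $1$ with fiber a variety $F$ if for all but finitely many prime divisors $D$ of $B$ the preimage $\pi^{-1}(D)$ is irreducible and $\pi^{-1}(D)_{\mathrm{red}}$ is birational to $(D\times F)_{\mathrm{red}}$ over $D$. Its vertical divisorial defect is $$d(\pi)=\sum_{D}\bigl([\pi^{-1}(D)]-[F\times D]\bigr)\in \mathrm{Burn}_*(\mathbb k),$$ where $D$ runs over the prime divisors of $B$ and $[\pi^{-1}(D)]$ is the sum of the classes of the prime divisors of $X$ contained in $\pi^{-1}(D)$, without multiplicities. **Theorem.** Let $\pi_1\colon X_1\to B_1$ and $\pi_2\colon X_2\to B_2$ be flat morphisms of normal varieties that are birationally trivial in codimension $1$ with the same fiber $F$. Then the sums defining $d(\pi_1)$ and $d(\pi_2)$ have only finitely many non-zero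 terms, and for every $\phi\in\mathrm{Bir}(\pi_1,\pi_2)$ with induced birational map $\sigma\colon B_1\dashrightarrow B_2$, $$c_{\mathrm{ver}}(\phi)=d(\pi_2)-d(\pi_1)+c(\sigma)\cdot[F].$$ -/

import Mathlib

open CategoryTheory CategoryTheory.Limits AlgebraicGeometry TopologicalSpace Order
universe u
noncomputable section BirationalInvariants
namespace BirInv

/-- The closed subset `Z` of `X` with its reduced induced scheme structure. -/
def reducedSubscheme (X : Scheme.{u}) (Z : Closeds X) : Scheme.{u} :=
  (Scheme.IdealSheafData.vanishingIdeal Z).subscheme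

/-- The closed immersion of a closed subset with its reduced structure. -/
def reducedι (X : Scheme.{u}) (Z : Closeds X) : reducedSubscheme X Z ⟶ X :=
  (Scheme.IdealSheafData.vanishingIdeal Z).subschemeι

instance (X : Scheme.{u}) (Z : Closeds X) : IsClosedImmersion (reducedι X Z) :=
  inferInstanceAs (IsClosedImmersion (Scheme.IdealSheafData.vanishingIdeal Z).subschemeι)

theorem range_reducedι (X : Scheme.{u}) (Z : Closeds X) : Set.range (reducedι X Z) = Z := by
  refine (Scheme.IdealSheafData.range_subschemeι _).trans ?_
  rw [Scheme.IdealSheafData.coe_support_vanishingIdeal]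

instance (X : Scheme.{u}) (Z : Closeds X) : IsReduced (reducedSubscheme X Z) := by
  let I := Scheme.IdealSheafData.vanishingIdeal Z
  have : ∀ i, IsReduced (I.subschemeCover.openCover.X i) := by
    intro (U : X.affineOpens)
    change IsReduced (Spec (.of (Γ(X, U.1) ⧸ I.ideal U)))
    have : _root_.IsReduced (Γ(X, U.1) ⧸ I.ideal U) := by
      rw [← Ideal.isRadical_iff_quotient_reduced]
      exact PrimeSpectrum.isRadical_vanishingIdeal _
    infer_instance
  exact IsReduced.of_openCover (X := I.subscheme) I.subschemeCover.openCover

theorem ker_eq_of_isReduced {Y X : Scheme.{u}} [IsReduced Y] (f : Y ⟶ X) :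
    f.ker = Scheme.IdealSheafData.vanishingIdeal (.closure (Set.range f)) := by
  rw [← Scheme.IdealSheafData.map_bot, ← Scheme.nilradical_eq_bot,
    ← Scheme.IdealSheafData.vanishingIdeal_top, Scheme.IdealSheafData.map_vanishingIdeal]
  simp

/-- Two closed immersions from reduced schemes with the same image are isomorphic. -/
theorem exists_iso_of_range_eq {Y Y' X : Scheme.{u}} [IsReduced Y] [IsReduced Y']
    (f : Y ⟶ X) (g : Y' ⟶ X) [IsClosedImmersion f] [IsClosedImmersion g]
    (h : Set.range f = Set.range g) : ∃ e : Y ≅ Y', e.hom ≫ g = f := by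
  have hk : g.ker = f.ker := by
    rw [ker_eq_of_isReduced, ker_eq_of_isReduced, h]
  have := IsClosedImmersion.isIso_lift g f hk
  exact ⟨asIso (IsClosedImmersion.lift g f hk.le), IsClosedImmersion.lift_fac g f hk.le⟩

variable {k : Type u} [Field k]

/-- A variety over `k`: an integral scheme, separated and of finite type over `k`
(not necessarily geometrically integral). -/
structure Variety (k : Type u) [Field k] where
  toScheme : Scheme.{u}
  str : toScheme ⟶ Spec (.of k)
  [isIntegral : IsIntegral toScheme]
  [isSeparated : IsSeparated str]
  [locallyOfFiniteType : LocallyOfFiniteType str]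
  [quasiCompact : QuasiCompact str]

attribute [instance] Variety.isIntegral Variety.isSeparated Variety.locallyOfFiniteType
  Variety.quasiCompact

instance {X : Scheme.{u}} (x : X) : IsIntegral (reducedSubscheme X (.closure {x})) := by
  have : IrreducibleSpace (reducedSubscheme X (.closure {x})) := by
    have h : IsIrreducible (Set.range (reducedι X (.closure {x}))) := by
      rw [range_reducedι]; exact isIrreducible_singleton.closure
    have := Subtype.irreducibleSpace h
    exact ((reducedι X (.closure {x})).isEmbedding.toHomeomorph.symm.surjective.irreducibleSpace
      (reducedι X (.closure {x})).isEmbedding.toHomeomorph.symm.continuous)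
  exact isIntegral_of_irreducibleSpace_of_isReduced _

/-- The closure of a point `z` of a separated `k`-scheme of finite type `Z`, with its reduced
structure: the integral closed subscheme of `Z` with generic point `z`, as a variety. -/
def closureVariety {Z : Scheme.{u}} (s : Z ⟶ Spec (.of k)) [IsSeparated s]
    [LocallyOfFiniteType s] [QuasiCompact s] (z : Z) : Variety k where
  toScheme := reducedSubscheme Z (.closure {z})
  str := reducedι Z (.closure {z}) ≫ s

/-- Birational equivalence of varieties over `k`. -/
instance variety_setoid (k : Type u) [Field k] : Setoid (Variety k) where
  r X Y := Scheme.BirationalOver X.str Y.str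
  iseqv := ⟨fun X ↦ .refl X.str, .symm, .trans⟩

/-- Birational isomorphism classes of `k`-varieties. -/
def BirClass (k : Type u) [Field k] : Type (u + 1) := Quotient (variety_setoid k)

/-- The Burnside group: the free abelian group on the birational isomorphism classes of
`k`-varieties. -/
def Burn (k : Type u) [Field k] : Type (u + 1) := FreeAbelianGroup (BirClass k)

instance (k : Type u) [Field k] : AddCommGroup (Burn k) :=
  inferInstanceAs (AddCommGroup (FreeAbelianGroup (BirClass k)))

/-- The class `[X]` of a variety. -/
def Burn.cls (X : Variety k) : Burn k := FreeAbelianGroup.of (Quotient.mk _ X)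

/-- The class of the integral closed subscheme of `Z` with generic point `z`. -/
def pointClass {Z : Scheme.{u}} (s : Z ⟶ Spec (.of k)) [IsSeparated s]
    [LocallyOfFiniteType s] [QuasiCompact s] (z : Z) : Burn k := .cls (closureVariety s z)

/-- Closures of corresponding points under an open immersion are birational. -/
theorem birational_closure_of_isOpenImmersion {U Z : Scheme.{u}} (j : U ⟶ Z) [IsOpenImmersion j]
    (u : U) {S : Scheme.{u}} (s : Z ⟶ S) (t : U ⟶ S) (h : j ≫ s = t) :
    Scheme.BirationalOver (reducedι U (.closure {u}) ≫ t)
      (reducedι Z (.closure {j u}) ≫ s) := by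
  let c := reducedι Z (.closure {j u})
  let p := pullback.fst c j
  have : IsReduced (pullback c j) := isReduced_of_isOpenImmersion p
  obtain ⟨e, he⟩ := exists_iso_of_range_eq (reducedι U (.closure {u})) (pullback.snd c j) (by
    rw [range_reducedι, Scheme.Pullback.range_snd, range_reducedι]
    simp only [Closeds.coe_closure]
    rw [j.isOpenEmbedding.isEmbedding.closure_eq_preimage_closure_image, Set.image_singleton])
  let q : reducedSubscheme U (.closure {u}) ⟶ reducedSubscheme Z (.closure {j u}) := e.hom ≫ p
  have hne : Nonempty (reducedSubscheme U (.closure {u})) := inferInstance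
  have : IsDominant q := ⟨q.isOpenEmbedding.isOpen_range.dense (Set.range_nonempty _)⟩
  refine q.birationalOver _ _ ?_
  simp only [q, p, Category.assoc]
  rw [← h, pullback.condition_assoc, reassoc_of% he]

/-- The class of the closure of a point can be computed on an open neighbourhood. -/
theorem pointClass_of_isOpenImmersion {U Z : Scheme.{u}} (j : U ⟶ Z) [IsOpenImmersion j]
    (s : Z ⟶ Spec (.of k)) (t : U ⟶ Spec (.of k)) (h : j ≫ s = t) [IsSeparated s]
    [LocallyOfFiniteType s] [QuasiCompact s] [IsSeparated t]
    [LocallyOfFiniteType t] [QuasiCompact t] (u : U) :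
    pointClass t u = pointClass s (j u) :=
  congrArg FreeAbelianGroup.of
    (Quotient.sound (birational_closure_of_isOpenImmersion j u s t h))


/-- The sum of the classes of the irreducible components of `Z`, each with its reduced structure.
The components are indexed by their generic points, which are the points of codimension zero;
there are finitely many of them by `finite_coheight_zero`. -/
def componentsClass {Z : Scheme.{u}} (s : Z ⟶ Spec (.of k)) [IsSeparated s]
    [LocallyOfFiniteType s] [QuasiCompact s] : Burn k :=
  ∑ᶠ z : {z : Z // coheight z = 0}, pointClass s z.1

theorem componentsClass_of_isOpenImmersion {U Z : Scheme.{u}} (j : U ⟶ Z) [IsOpenImmersion j]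
    (s : Z ⟶ Spec (.of k)) (t : U ⟶ Spec (.of k)) (h : j ≫ s = t) [IsSeparated s]
    [LocallyOfFiniteType s] [QuasiCompact s] [IsSeparated t]
    [LocallyOfFiniteType t] [QuasiCompact t]
    (hj : ∀ z : Z, coheight z = 0 → z ∈ Set.range j) :
    componentsClass t = componentsClass s := by
  refine finsum_eq_of_bijective
    (fun u ↦ ⟨j u.1, (coheight_eq_of_isOpenImmersion j).trans u.2⟩) ⟨?_, ?_⟩ ?_
  · intro u v huv
    exact Subtype.ext (j.isOpenEmbedding.injective congr(($huv).1))
  · rintro ⟨z, hz⟩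
    obtain ⟨u, rfl⟩ := hj z hz
    exact ⟨⟨u, (coheight_eq_of_isOpenImmersion j).symm.trans hz⟩, rfl⟩
  · intro u
    exact pointClass_of_isOpenImmersion j s t h u.1

/-- The structure morphism `X ×ₖ Y → Spec k`. -/
def prodStr (X Y : Variety k) : pullback X.str Y.str ⟶ Spec (.of k) :=
  pullback.fst X.str Y.str ≫ X.str

instance (X Y : Variety k) : IsSeparated (prodStr X Y) := by unfold prodStr; infer_instance
instance (X Y : Variety k) : LocallyOfFiniteType (prodStr X Y) := by
  unfold prodStr; infer_instance
instance (X Y : Variety k) : QuasiCompact (prodStr X Y) := by unfold prodStr; infer_instance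

/-- The class `[X ×ₖ Y]`: the sum of the classes of the irreducible components of
`(X ×ₖ Y)_red`. -/
def prodClass (X Y : Variety k) : Burn k := componentsClass (prodStr X Y)

theorem prodClass_comm (X Y : Variety k) : prodClass X Y = prodClass Y X := by
  refine componentsClass_of_isOpenImmersion (pullbackSymmetry X.str Y.str).hom _ _ ?_ ?_
  · simp [prodStr, pullback.condition]
  · intro z _
    exact (pullbackSymmetry X.str Y.str).hom.surjective z

/-- A flat morphism between irreducible schemes maps the generic point to the generic point. -/
theorem flat_apply_genericPoint {X Y : Scheme.{u}} [IrreducibleSpace X] [IrreducibleSpace Y]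
    (f : X ⟶ Y) [Flat f] : f (genericPoint X) = genericPoint Y := by
  obtain ⟨x, -, hx⟩ := Flat.generalizingMap f
    (genericPoint_specializes (f (genericPoint X)))
  refine Specializes.antisymm ?_ (genericPoint_specializes _) |>.eq
  rw [← hx]
  exact (genericPoint_specializes x).map f.continuous

instance (priority := 100) {X Y : Scheme.{u}} [IsIntegral X] [IsIntegral Y]
    (f : X ⟶ Y) [Flat f] : IsDominant f := by
  refine ⟨(dense_iff_closure_eq.mpr ?_ : Dense ({genericPoint Y} : Set Y)).mono ?_⟩
  · exact genericPoint_closure Y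
  · rw [Set.singleton_subset_iff, ← flat_apply_genericPoint f]
    exact Set.mem_range_self _

/-- Generic points of components of `X ×ₖ Y` lie over the generic point of `X`. -/
theorem fst_eq_genericPoint (X Y : Variety k) (z : (pullback X.str Y.str : Scheme.{u}))
    (hz : coheight z = 0) :
    pullback.fst X.str Y.str z = genericPoint X.toScheme := by
  have hmax : IsMax z := coheight_eq_zero.mp hz
  obtain ⟨x, hx, hx'⟩ := Flat.generalizingMap (pullback.fst X.str Y.str)
    (genericPoint_specializes (pullback.fst X.str Y.str z))
  have hzx : z ⤳ x := hmax hx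
  refine Specializes.antisymm ?_ (genericPoint_specializes _) |>.eq
  rw [← hx']
  exact hzx.map (pullback.fst X.str Y.str).continuous

theorem prodClass_of_isOpenImmersion (X X' Y : Variety k) (j : X.toScheme ⟶ X'.toScheme)
    [IsOpenImmersion j] (h : j ≫ X'.str = X.str) : prodClass X Y = prodClass X' Y := by
  let m := pullback.map X.str Y.str X'.str Y.str j (𝟙 _) (𝟙 _) (by simp [h]) (by simp)
  have hm : m ≫ pullback.fst X'.str Y.str = pullback.fst X.str Y.str ≫ j :=
    pullback.lift_fst _ _ _
  refine componentsClass_of_isOpenImmersion m _ _ ?_ ?_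
  · rw [prodStr, reassoc_of% hm, h, prodStr]
  · intro z hz
    rw [Scheme.Pullback.range_map]
    simp [fst_eq_genericPoint X' Y z hz]
    exact ⟨_, genericPoint_eq_of_isOpenImmersion j⟩

/-- A nonempty open subscheme of a variety, as a variety. -/
def Variety.restrict (X : Variety k) (U : X.toScheme.Opens) [Nonempty U] : Variety k where
  toScheme := U
  str := U.ι ≫ X.str
  quasiCompact := by
    have := LocallyOfFiniteType.isLocallyNoetherian X.str
    infer_instance

theorem prodClass_left_congr (X X' Y : Variety k) (h : X ≈ X') :
    prodClass X Y = prodClass X' Y := by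
  obtain ⟨f, hf⟩ : Scheme.BirationalOver X.str X'.str := h
  have : Nonempty f.source := f.dense_source.nonempty.to_subtype
  let j : (X.restrict f.source).toScheme ⟶ X.toScheme := f.source.ι
  let j' : (X.restrict f.source).toScheme ⟶ X'.toScheme := f.iso.hom ≫ f.target.ι
  have : IsOpenImmersion j := inferInstanceAs (IsOpenImmersion f.source.ι)
  have : IsOpenImmersion j' := inferInstanceAs (IsOpenImmersion (f.iso.hom ≫ f.target.ι))
  have h₁ := prodClass_of_isOpenImmersion (X.restrict f.source) X Y j rfl
  have h₂ := prodClass_of_isOpenImmersion (X.restrict f.source) X' Y j'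
    ((Category.assoc _ _ _).trans hf)
  exact h₁.symm.trans h₂

/-- The bilinear extension of `[X] · [Y] = [X ×ₖ Y]`. -/
def Burn.mulHom (k : Type u) [Field k] : Burn k →+ Burn k →+ Burn k :=
  FreeAbelianGroup.lift fun a ↦ FreeAbelianGroup.lift fun b ↦
    Quotient.liftOn₂ a b prodClass fun X Y X' Y' hX hY ↦ by
      rw [prodClass_left_congr X X' Y hX, prodClass_comm X' Y,
        prodClass_left_congr Y Y' X' hY, prodClass_comm Y' X']

/-- The product of the Burnside ring. -/
instance : Mul (Burn k) := ⟨fun x y ↦ Burn.mulHom k x y⟩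

theorem Burn.cls_mul_cls (X Y : Variety k) : Burn.cls X * Burn.cls Y = prodClass X Y := by
  change Burn.mulHom k _ _ = _
  erw [Burn.mulHom, FreeAbelianGroup.lift_apply_of, FreeAbelianGroup.lift_apply_of]
  rfl


instance (X : Variety k) : IsNoetherian X.toScheme := by
  have := LocallyOfFiniteType.isLocallyNoetherian X.str
  have := QuasiCompact.compactSpace_of_compactSpace X.str
  exact {}

/-- The maximal points (under generization) of a closed subset of a Noetherian scheme, that is,
the generic points of its irreducible components, form a finite set. -/
theorem finite_maximal_points {X : Scheme.{u}} [NoetherianSpace X] (Z : Set X)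
    (hZ : IsClosed Z) : {x ∈ Z | ∀ y ∈ Z, x ≤ y → y ≤ x}.Finite := by
  obtain ⟨S, hS, hS', hi, hZS⟩ := NoetherianSpace.exists_finite_set_isClosed_irreducible hZ
  choose g hg using fun T : S ↦ QuasiSober.sober (hi T.1 T.2) (hS' T.1 T.2)
  have := hS.to_subtype
  refine (Set.finite_range g).subset ?_
  rintro x ⟨hxZ, hx⟩
  obtain ⟨T, hT, hxT⟩ : ∃ T ∈ S, x ∈ T := by rwa [hZS] at hxZ
  have h₁ : g ⟨T, hT⟩ ⤳ x := (hg ⟨T, hT⟩).specializes hxT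
  have h₂ : g ⟨T, hT⟩ ∈ Z := by
    rw [hZS]
    exact ⟨T, hT, (hg ⟨T, hT⟩).mem⟩
  have h₃ : x ⤳ g ⟨T, hT⟩ := hx _ h₂ h₁
  exact ⟨⟨T, hT⟩, (h₁.antisymm h₃).eq⟩

/-- A Noetherian scheme has finitely many irreducible components. -/
theorem finite_coheight_zero (X : Scheme.{u}) [NoetherianSpace X] :
    {x : X | coheight x = 0}.Finite :=
  (finite_maximal_points Set.univ isClosed_univ).subset fun _ hx ↦
    ⟨trivial, fun _ _ h ↦ (coheight_eq_zero.mp hx) h⟩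

/-- A proper closed subset of a variety contains only finitely many prime divisors. -/
theorem finite_coheight_one {X : Scheme.{u}} [IrreducibleSpace X] [NoetherianSpace X]
    (Z : Set X) (hZ : IsClosed Z) (h : Z ≠ Set.univ) : {x ∈ Z | coheight x = 1}.Finite := by
  refine (finite_maximal_points Z hZ).subset fun x ⟨hxZ, hx⟩ ↦ ⟨hxZ, fun y hy hxy ↦ ?_⟩
  by_contra hyx
  have hη : y < genericPoint X := by
    refine ⟨genericPoint_specializes y, fun hs ↦ h ?_⟩
    have : genericPoint X ∈ Z := (show y ⤳ genericPoint X from hs).mem_closed hZ hy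
    exact Set.eq_univ_of_univ_subset
      ((genericPoint_closure X).symm.subset.trans
        (hZ.closure_subset_iff.mpr (Set.singleton_subset_iff.mpr this)))
  have h₁ : coheight y + 1 ≤ coheight x := coheight_add_one_le ⟨hxy, hyx⟩
  have h₂ : coheight (genericPoint X) + 1 ≤ coheight y := coheight_add_one_le hη
  rw [hx] at h₁
  have h₃ : (1 : ℕ∞) ≤ coheight y := le_add_self.trans h₂
  have h₄ : (1 : ℕ∞) + 1 ≤ 1 := (add_le_add_left h₃ 1).trans h₁
  norm_num at h₄

/-- The prime (Weil) divisors of a variety, each given by its generic point: the points of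
codimension one. (In the specialization order, `coheight x` is the codimension of the closure
of `x`.) -/
def PrimeDivisor (X : Variety k) : Type u := {x : X.toScheme // coheight x = 1}

/-- A scheme is normal if its local rings are integrally closed. (It is only used for integral
schemes, whose local rings are domains.) -/
def IsNormalScheme (X : Scheme.{u}) : Prop := ∀ x : X, IsIntegrallyClosed (X.presheaf.stalk x)

/-- A birational map `X ⇢ Y` of `k`-varieties, together with its inverse: rational maps that are
given by an isomorphism over `k` between dense open subschemes. -/
structure BirMap (X Y : Variety k) where
  hom : X.toScheme ⤏ Y.toScheme
  inv : Y.toScheme ⤏ X.toScheme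
  exists_partialIso : ∃ f : X.toScheme.PartialIso Y.toScheme,
    f.IsOver X.str Y.str ∧ f.toRationalMap = hom ∧ f.symm.toRationalMap = inv

namespace BirMap

/-- The inverse birational map. -/
def symm {X Y : Variety k} (φ : BirMap X Y) : BirMap Y X where
  hom := φ.inv
  inv := φ.hom
  exists_partialIso := by
    obtain ⟨f, hf, h₁, h₂⟩ := φ.exists_partialIso
    exact ⟨f.symm, hf.symm, h₂, h₁⟩

/-- The exceptional divisors of `φ : X ⇢ Y`: the prime divisors of `X` at whose generic point `φ`
is not a local isomorphism, that is, no isomorphism between dense open subschemes of `X` and `Y`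
that represents `φ` is defined at that point. -/
def exDiv {X Y : Variety k} (φ : BirMap X Y) : Set X.toScheme :=
  {x | coheight x = 1 ∧
    ∀ f : X.toScheme.PartialIso Y.toScheme, f.toRationalMap = φ.hom → x ∉ f.source}

/-- A birational map has only finitely many exceptional divisors. -/
theorem finite_exDiv {X Y : Variety k} (φ : BirMap X Y) : φ.exDiv.Finite := by
  obtain ⟨f, -, hf, -⟩ := φ.exists_partialIso
  refine (finite_coheight_one (f.source : Set X.toScheme)ᶜ f.source.isOpen.isClosed_compl
    ?_).subset fun x hx ↦ ⟨hx.2 f hf, hx.1⟩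
  rw [Ne, Set.compl_univ_iff]
  exact f.dense_source.nonempty.ne_empty

/-- The motivic invariant: the sum of the classes of the exceptional divisors of the inverse,
minus the sum of the classes of the exceptional divisors. -/
def c {X Y : Variety k} (φ : BirMap X Y) : Burn k :=
  (∑ᶠ y ∈ φ.symm.exDiv, pointClass Y.str y) - ∑ᶠ x ∈ φ.exDiv, pointClass X.str x

end BirMap

/-- A birational map between `π₁` and `π₂`: birational maps `φ : X₁ ⇢ X₂` (`total`) and
`σ : B₁ ⇢ B₂` (`base`) over `k` with `σ ∘ π₁ = π₂ ∘ φ` as rational maps. -/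
structure BirSquare {X₁ B₁ X₂ B₂ : Variety k} (π₁ : X₁.toScheme ⟶ B₁.toScheme)
    (π₂ : X₂.toScheme ⟶ B₂.toScheme) [IsDominant π₁] where
  total : BirMap X₁ X₂
  base : BirMap B₁ B₂
  comm : π₁.toRationalMap.comp base.hom = total.hom.compHom π₂

/-- The integral closed subscheme of `X` with generic point `x` does not dominate `B`. -/
def IsVertical {X B : Scheme.{u}} (π : X ⟶ B) (x : X) : Prop :=
  closure (π '' closure {x}) ≠ Set.univ

/-- The vertical motivic invariant: the motivic invariant restricted to the exceptional divisors
that do not dominate the respective base. -/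
def BirSquare.cVer {X₁ B₁ X₂ B₂ : Variety k} {π₁ : X₁.toScheme ⟶ B₁.toScheme}
    {π₂ : X₂.toScheme ⟶ B₂.toScheme} [IsDominant π₁] (φ : BirSquare π₁ π₂) : Burn k :=
  (∑ᶠ y ∈ {y ∈ φ.total.symm.exDiv | IsVertical π₂ y}, pointClass X₂.str y) -
    ∑ᶠ x ∈ {x ∈ φ.total.exDiv | IsVertical π₁ x}, pointClass X₁.str x

section FixedMorphism

variable {X B : Variety k} (π : X.toScheme ⟶ B.toScheme)

/-- The class `[π⁻¹(D)]`: the sum of the classes of the prime divisors of `X` contained in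
`π⁻¹(D)`, without multiplicities. -/
def preimageClass (D : PrimeDivisor B) : Burn k :=
  ∑ᶠ x ∈ {x : X.toScheme | coheight x = 1 ∧ π x ∈ closure {D.1}}, pointClass X.str x

/-- For flat `π` the sum in `preimageClass` is finite. -/
theorem finite_preimage [Flat π] (D : PrimeDivisor B) :
    {x : X.toScheme | coheight x = 1 ∧ π x ∈ closure {D.1}}.Finite := by
  refine (finite_coheight_one (π ⁻¹' closure {D.1}) (isClosed_closure.preimage π.continuous)
    fun h ↦ ?_).subset fun x hx ↦ ⟨hx.2, hx.1⟩
  have h₁ : D.1 ⤳ genericPoint B.toScheme := by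
    rw [specializes_iff_mem_closure, ← flat_apply_genericPoint π]
    exact h.symm.subset trivial
  have h₂ : IsMax D.1 := fun y _ ↦ h₁.trans (genericPoint_specializes y)
  have h₃ := D.2
  rw [coheight_eq_zero.mpr h₂] at h₃
  exact zero_ne_one h₃

/-- A prime divisor as a variety. -/
def PrimeDivisor.toVariety (D : PrimeDivisor B) : Variety k := closureVariety B.str D.1

/-- For all but finitely many prime divisors `D` of `B`, the preimage `π⁻¹(D)` is irreducible and
birational to `D × F` over `D`, for the reduced structures. (Being birational over `D` is
expressed over `B`; this is the same since `D → B` is a monomorphism.) Flatness of `π` and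
normality of `X` and `B` are separate hypotheses. -/
def IsBirTrivialInCodimOne (F : Variety k) : Prop :=
  {D : PrimeDivisor B | ¬ (IsIrreducible (π ⁻¹' closure {D.1}) ∧
    Scheme.BirationalOver
      (reducedι X.toScheme ((Closeds.closure {D.1}).preimage π.continuous) ≫ π)
      (reducedι (pullback D.toVariety.str F.str) ⊤ ≫ pullback.fst D.toVariety.str F.str ≫
        reducedι B.toScheme (.closure {D.1})))}.Finite

/-- The summand `[π⁻¹(D)] - [F × D]` of the vertical divisorial defect. -/
def defectTerm (F : Variety k) (D : PrimeDivisor B) : Burn k :=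
  preimageClass π D - prodClass F D.toVariety

/-- The vertical divisorial defect `d(π)`. -/
def defect (F : Variety k) : Burn k := ∑ᶠ D : PrimeDivisor B, defectTerm π F D

end FixedMorphism

end BirInv

end BirationalInvariants

open BirInv

open BirInv

/-! Prime divisors are handled through their generic points. Separatedness makes
`BirMap.Corresponds` a partial bijection: points where `φ` is a local isomorphism are matched with
points where `φ⁻¹` is, preserving codimension and birational class. The commutative square then
relates the images in the bases wherever `σ` is also a local isomorphism
(`apply_eq_of_corresponds`).

Flatness puts every vertical prime divisor of `X` over exactly one prime divisor of `B`. Hence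
`d(π)` splits (`defect_eq`) into the vertical exceptional divisors of `φ`, the remaining terms over
`D` not exceptional for `σ`, and, for `D` exceptional for `σ`, the non-exceptional divisors over `D`
minus `[F × D]`. The second part agrees on both sides because `σ` matches the `D`
(`finsum_restTerm_eq`). The divisors in the third part also match, though not one `D` at a time
(`finsum_over_exDiv_eq`). In `d(π₂) - d(π₁)` this leaves `c_ver(φ) - c(σ)·[F]`.

Finiteness of `d(π)` comes from `defectTerm_eq_zero`: by flatness and Krull's theorem an irreducible
`π⁻¹(D)` is a single prime divisor, birational to `D × F` for almost all `D`. -/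

namespace BirInv

/-! ### Values, composition and inverses of rational maps -/

section RationalMaps

variable {X Y Z : Scheme.{u}}

/-- Two partial maps that represent the same rational map agree where both are defined. -/
theorem partialMap_apply_eq [IsReduced X] [Y.IsSeparated] {f g : X.PartialMap Y}
    (h : f.toRationalMap = g.toRationalMap) (u : f.domain.toScheme) (v : g.domain.toScheme)
    (huv : f.domain.ι u = g.domain.ι v) : f.hom u = g.hom v := by
  have h' := (Scheme.PartialMap.equiv_iff_of_isSeparated (S := ⊤_ _)).mp
    (Scheme.PartialMap.toRationalMap_eq_iff.mp h)
  have hu : u.1 = v.1 := huv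
  let w : (f.domain ⊓ g.domain : X.Opens).toScheme := ⟨u.1, u.2, hu ▸ v.2⟩
  have h₁ : X.homOfLE (inf_le_left : f.domain ⊓ g.domain ≤ f.domain) w = u := by
    apply f.domain.ι.isOpenEmbedding.injective
    rw [← Scheme.Hom.comp_apply, Scheme.homOfLE_ι]; rfl
  have h₂ : X.homOfLE (inf_le_right : f.domain ⊓ g.domain ≤ g.domain) w = v := by
    apply g.domain.ι.isOpenEmbedding.injective
    rw [← Scheme.Hom.comp_apply, Scheme.homOfLE_ι]; exact huv
  have h₃ : f.hom (X.homOfLE (inf_le_left : f.domain ⊓ g.domain ≤ f.domain) w) =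
    g.hom (X.homOfLE (inf_le_right : f.domain ⊓ g.domain ≤ g.domain) w) := congr($h' w)
  rwa [h₁, h₂] at h₃

/-- The value of a composition of partial maps at a point. -/
theorem partialMap_comp_apply [PreirreducibleSpace X] [Nonempty Y] (f : X.PartialMap Y)
    [IsDominant f.hom] (g : Y.PartialMap Z) (u : f.domain.toScheme) (v : g.domain.toScheme)
    (h : f.hom u = g.domain.ι v) :
    ∃ w : (f.comp g).domain.toScheme, (f.comp g).domain.ι w = f.domain.ι u ∧
      (f.comp g).hom w = g.hom v := by
  let u' : (f.hom ⁻¹ᵁ g.domain : f.domain.toScheme.Opens).toScheme :=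
    ⟨u, show f.hom u ∈ g.domain from h ▸ v.2⟩
  refine ⟨(f.domain.ι.isoImage (f.hom ⁻¹ᵁ g.domain)).hom u', ?_, ?_⟩
  · have := congr($(f.domain.ι.isoImage_hom_ι (f.hom ⁻¹ᵁ g.domain)) u')
    exact this
  · have h₁ : (f.domain.ι.isoImage (f.hom ⁻¹ᵁ g.domain)).hom ≫ (f.comp g).hom =
        f.hom ∣_ g.domain ≫ g.hom := by
      rw [Scheme.PartialMap.comp_hom]; exact Iso.hom_inv_id_assoc _ _
    have h₂ : (f.hom ∣_ g.domain) u' = v := by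
      apply g.domain.ι.isOpenEmbedding.injective
      rw [← Scheme.Hom.comp_apply, morphismRestrict_ι, Scheme.Hom.comp_apply]
      exact h
    have h₃ : (f.comp g).hom ((f.domain.ι.isoImage (f.hom ⁻¹ᵁ g.domain)).hom u') =
      g.hom ((f.hom ∣_ g.domain) u') := congr($h₁ u')
    rwa [h₂] at h₃

instance (f : X.PartialIso Y) : IsDominant f.toPartialMap.hom := by
  have := Opens.isDominant_ι f.dense_target
  exact inferInstanceAs (IsDominant (f.iso.hom ≫ f.target.ι))

theorem partialIso_comp_symm [IrreducibleSpace X] [IrreducibleSpace Y] (f : X.PartialIso Y) :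
    f.toRationalMap.comp f.symm.toRationalMap = Scheme.RationalMap.id X := by
  rw [Scheme.RationalMap.toRationalMap_comp, Scheme.PartialMap.toRationalMap_eq_iff]
  refine ⟨_, (f.toPartialMap.comp f.symm.toPartialMap).dense_domain, le_rfl, le_top, ?_⟩
  have h : (f.iso.hom ≫ f.target.ι) ∣_ f.target =
      ((f.iso.hom ≫ f.target.ι) ⁻¹ᵁ f.target).ι ≫ f.iso.hom := by
    rw [← cancel_mono f.target.ι, morphismRestrict_ι, Category.assoc]
  have h' : (f.source.ι.isoImage ((f.iso.hom ≫ f.target.ι) ⁻¹ᵁ f.target)).inv ≫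
      (f.iso.hom ≫ f.target.ι) ∣_ f.target ≫ f.iso.inv ≫ f.source.ι =
      (f.source.ι ''ᵁ ((f.iso.hom ≫ f.target.ι) ⁻¹ᵁ f.target)).ι := by
    rw [h, Category.assoc, Iso.hom_inv_id_assoc, Scheme.Hom.isoImage_inv_ι]
  have h'' : X.homOfLE (le_top (a := f.source.ι ''ᵁ ((f.iso.hom ≫ f.target.ι) ⁻¹ᵁ f.target))) ≫
      X.topIso.hom ≫ 𝟙 X = (f.source.ι ''ᵁ ((f.iso.hom ≫ f.target.ι) ⁻¹ᵁ f.target)).ι := by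
    rw [Category.comp_id, Scheme.topIso_hom, Scheme.homOfLE_ι]
  refine (congrArg (· ≫ _) (X.homOfLE_rfl _)).trans ?_
  exact (Category.id_comp _).trans (h'.trans h''.symm)

/-- Uniqueness of inverses. It allows any representative of a birational map to be inverted, not
only the one stored with it. -/
theorem partialIso_symm_eq [IrreducibleSpace X] [IrreducibleSpace Y] {f g : X.PartialIso Y}
    (h : f.toRationalMap = g.toRationalMap) : f.symm.toRationalMap = g.symm.toRationalMap := by
  have h₁ := partialIso_comp_symm g
  have h₂ : f.symm.toRationalMap.comp f.toRationalMap = _ := partialIso_comp_symm f.symm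
  have h₃ : f.symm.toRationalMap.comp g.toRationalMap = Scheme.RationalMap.id Y := h ▸ h₂
  have h₄ := Scheme.RationalMap.comp_assoc f.symm.toRationalMap g.toRationalMap
    g.symm.toRationalMap
  simp only [h₃] at h₄
  rwa [h₁, Scheme.RationalMap.comp_id, Scheme.RationalMap.id_comp, eq_comm] at h₄

end RationalMaps

variable {k : Type u} [Field k]

/-- Absolute separatedness lets representatives of a rational map be compared without first knowing
that they are morphisms over `k`. -/
instance (X : Variety k) : X.toScheme.IsSeparated := by
  have h : X.str ≫ terminal.from _ = terminal.from X.toScheme := Subsingleton.elim _ _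
  exact ⟨h ▸ inferInstance⟩

/-! ### Points matched by a birational map -/

namespace BirMap

variable {X Y : Variety k}

/-- The birational map `φ` is a local isomorphism at `x` and maps `x` to `y`. -/
def Corresponds (φ : BirMap X Y) (x : X.toScheme) (y : Y.toScheme) : Prop :=
  ∃ f : X.toScheme.PartialIso Y.toScheme, f.toRationalMap = φ.hom ∧
    ∃ u : f.source.toScheme, f.source.ι u = x ∧ f.target.ι (f.iso.hom u) = y

theorem symm_toRationalMap (φ : BirMap X Y) {f : X.toScheme.PartialIso Y.toScheme}
    (h : f.toRationalMap = φ.hom) : f.symm.toRationalMap = φ.inv := by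
  obtain ⟨g, -, hg, hg'⟩ := φ.exists_partialIso
  rw [← hg', partialIso_symm_eq (h.trans hg.symm)]

theorem Corresponds.symm {φ : BirMap X Y} {x : X.toScheme} {y : Y.toScheme}
    (h : φ.Corresponds x y) : φ.symm.Corresponds y x := by
  obtain ⟨f, hf, u, rfl, rfl⟩ := h
  refine ⟨f.symm, φ.symm_toRationalMap hf, f.iso.hom u, rfl, ?_⟩
  exact congr(f.source.ι ($(f.iso.hom_inv_id) u))

/-- The two hypotheses may come from different representatives of `φ`; these agree at `x` because
`Y` is separated. -/
theorem Corresponds.right_unique {φ : BirMap X Y} {x : X.toScheme} {y y' : Y.toScheme}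
    (h : φ.Corresponds x y) (h' : φ.Corresponds x y') : y = y' := by
  obtain ⟨f, hf, u, rfl, rfl⟩ := h
  obtain ⟨g, hg, v, hv, rfl⟩ := h'
  exact partialMap_apply_eq (f := f.toPartialMap) (g := g.toPartialMap) (hf.trans hg.symm) u v
    hv.symm

theorem Corresponds.left_unique {φ : BirMap X Y} {x x' : X.toScheme} {y : Y.toScheme}
    (h : φ.Corresponds x y) (h' : φ.Corresponds x' y) : x = x' :=
  h.symm.right_unique h'.symm

theorem Corresponds.coheight_eq {φ : BirMap X Y} {x : X.toScheme} {y : Y.toScheme}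
    (h : φ.Corresponds x y) : coheight x = coheight y := by
  obtain ⟨f, -, u, rfl, rfl⟩ := h
  rw [coheight_eq_of_isOpenImmersion, coheight_eq_of_isOpenImmersion,
    coheight_eq_of_isOpenImmersion]

theorem notMem_exDiv_iff {φ : BirMap X Y} {x : X.toScheme} (hx : coheight x = 1) :
    x ∉ φ.exDiv ↔ ∃ y, φ.Corresponds x y := by
  constructor
  · intro h
    simp only [exDiv, Set.mem_ofPred_eq, hx, true_and, not_forall, not_not] at h
    obtain ⟨f, hf, hxf⟩ := h
    exact ⟨_, f, hf, ⟨x, hxf⟩, rfl, rfl⟩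
  · rintro ⟨y, f, hf, u, rfl, -⟩ h
    exact h.2 f hf u.2

theorem Corresponds.notMem_exDiv {φ : BirMap X Y} {x : X.toScheme} {y : Y.toScheme}
    (h : φ.Corresponds x y) : x ∉ φ.exDiv := fun hx ↦
  (notMem_exDiv_iff hx.1).mpr ⟨y, h⟩ hx

/-- Every isomorphism between dense open subschemes that represents a birational map over `k` is
an isomorphism over `k`. -/
theorem isOver_of_toRationalMap_eq (φ : BirMap X Y) {f : X.toScheme.PartialIso Y.toScheme}
    (h : f.toRationalMap = φ.hom) : f.IsOver X.str Y.str := by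
  obtain ⟨g, hg, hgφ, -⟩ := φ.exists_partialIso
  -- `f` and the `k`-representative `g` agree a priori only on a smaller dense open; separatedness
  -- extends the equality of maps to `Spec k` to all of `f.source`.
  have h₁ : (f.toPartialMap.compHom Y.str).equiv (g.toPartialMap.compHom Y.str) := by
    rw [← Scheme.PartialMap.toRationalMap_eq_iff, Scheme.RationalMap.compHom_toRationalMap,
      Scheme.RationalMap.compHom_toRationalMap]
    exact congrArg _ (h.trans hgφ.symm)
  have h₂ : (g.toPartialMap.compHom Y.str).equiv X.str.toPartialMap :=
    (Scheme.PartialMap.equiv_toPartialMap_iff_of_isSeparated (S := ⊤_ _)).mpr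
      ((Category.assoc _ _ _).trans hg)
  exact (Category.assoc _ _ _).symm.trans
    ((Scheme.PartialMap.equiv_toPartialMap_iff_of_isSeparated (S := ⊤_ _)).mp (h₁.trans h₂))

/-- The source of a representative is an open neighbourhood of both points, and passing to an open
neighbourhood does not change the birational class of a closure. -/
theorem Corresponds.birational {φ : BirMap X Y} {x : X.toScheme} {y : Y.toScheme}
    (h : φ.Corresponds x y) : closureVariety X.str x ≈ closureVariety Y.str y := by
  obtain ⟨f, hf, u, rfl, rfl⟩ := h
  have h₁ := birational_closure_of_isOpenImmersion f.source.ι u X.str _ rfl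
  have h₂ := birational_closure_of_isOpenImmersion (f.iso.hom ≫ f.target.ι) u Y.str
    (f.source.ι ≫ X.str) ((Category.assoc _ _ _).trans (φ.isOver_of_toRationalMap_eq hf))
  exact h₁.symm.trans h₂

theorem Corresponds.pointClass_eq {φ : BirMap X Y} {x : X.toScheme} {y : Y.toScheme}
    (h : φ.Corresponds x y) : pointClass X.str x = pointClass Y.str y :=
  congrArg FreeAbelianGroup.of (Quotient.sound h.birational)

theorem corresponds_genericPoint (φ : BirMap X Y) :
    φ.Corresponds (genericPoint X.toScheme) (genericPoint Y.toScheme) := by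
  obtain ⟨f, -, hf, -⟩ := φ.exists_partialIso
  have := f.dense_source.nonempty.to_subtype
  have : Nonempty f.source.toScheme := this
  refine ⟨f, hf, genericPoint f.source.toScheme, genericPoint_eq_of_isOpenImmersion f.source.ι, ?_⟩
  exact genericPoint_eq_of_isOpenImmersion (f.iso.hom ≫ f.target.ι)

instance (φ : BirMap X Y) : φ.hom.IsDominant := by
  obtain ⟨f, -, hf, -⟩ := φ.exists_partialIso
  rw [← hf]; infer_instance

instance (φ : BirMap X Y) : φ.inv.IsDominant := inferInstanceAs φ.symm.hom.IsDominant

theorem hom_comp_inv (φ : BirMap X Y) :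
    φ.hom.comp φ.inv = Scheme.RationalMap.id _ := by
  obtain ⟨f, -, hf, hf'⟩ := φ.exists_partialIso
  simp only [← hf, ← hf']
  exact partialIso_comp_symm f

end BirMap

/-! ### Commutative squares evaluated at points -/

namespace BirSquare

variable {X₁ B₁ X₂ B₂ : Variety k} {π₁ : X₁.toScheme ⟶ B₁.toScheme}
  {π₂ : X₂.toScheme ⟶ B₂.toScheme} [IsDominant π₁]

/-- The inverse of a birational map between two dominant morphisms. -/
def symm [IsDominant π₂] (φ : BirSquare π₁ π₂) : BirSquare π₂ π₁ where
  total := φ.total.symm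
  base := φ.base.symm
  comm := by
    change π₂.toRationalMap.comp φ.base.inv = φ.total.inv.compHom π₁
    have h := φ.comm
    rw [← Scheme.RationalMap.comp_toRationalMap] at h
    have h₁ : φ.total.inv.comp φ.total.hom = _ := φ.total.symm.hom_comp_inv
    have h₂ := φ.base.hom_comp_inv
    calc π₂.toRationalMap.comp φ.base.inv
        = ((φ.total.inv.comp φ.total.hom).comp π₂.toRationalMap).comp φ.base.inv := by
          simp only [h₁, Scheme.RationalMap.id_comp]
      _ = φ.total.inv.comp ((φ.total.hom.comp π₂.toRationalMap).comp φ.base.inv) := by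
          simp only [Scheme.RationalMap.comp_assoc]
      _ = φ.total.inv.comp ((π₁.toRationalMap.comp φ.base.hom).comp φ.base.inv) := by
          simp only [h]
      _ = φ.total.inv.comp π₁.toRationalMap := by
          rw [Scheme.RationalMap.comp_assoc, h₂, Scheme.RationalMap.comp_id]
      _ = _ := Scheme.RationalMap.comp_toRationalMap _ _

/-- The square commutes only as rational maps, but here both composites are defined at `x`, so
separatedness forces equal values there. -/
theorem apply_eq_of_corresponds (φ : BirSquare π₁ π₂) {x : X₁.toScheme} {y : X₂.toScheme}
    {b : B₂.toScheme} (h : φ.total.Corresponds x y) (hb : φ.base.Corresponds (π₁ x) b) :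
    π₂ y = b := by
  obtain ⟨f, hf, u, rfl, rfl⟩ := h
  obtain ⟨g, hg, v, hv, rfl⟩ := hb
  have h := φ.comm
  rw [← hf, ← hg, ← Scheme.RationalMap.compHom_toRationalMap,
    Scheme.RationalMap.toRationalMap_comp] at h
  obtain ⟨w, hw, hw'⟩ := partialMap_comp_apply π₁.toPartialMap g.toPartialMap
    ⟨f.source.ι u, trivial⟩ v hv.symm
  exact (partialMap_apply_eq h w u hw).symm.trans hw'

end BirSquare

/-! ### Codimension one under flat morphisms -/

section Divisors

theorem ne_genericPoint_of_coheight_eq_one {X : Scheme.{u}} [IrreducibleSpace X] {x : X}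
    (hx : coheight x = 1) : x ≠ genericPoint X := by
  rintro rfl
  rw [coheight_eq_zero.mpr fun y _ ↦ genericPoint_specializes y] at hx
  exact zero_ne_one hx

/-- A point of codimension one has no proper generization but the generic point. -/
theorem eq_or_eq_genericPoint_of_specializes {X : Scheme.{u}} [IrreducibleSpace X] {x y : X}
    (hx : coheight x = 1) (h : y ⤳ x) : y = x ∨ y = genericPoint X := by
  by_contra! hy
  have h₁ : x < y := ⟨h, fun h' ↦ hy.1 (h.antisymm h').eq⟩
  have h₂ : y < genericPoint X := ⟨genericPoint_specializes y,
    fun h' ↦ hy.2 ((show y ⤳ genericPoint X from h').antisymm (genericPoint_specializes y)).eq⟩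
  have h₃ := coheight_add_one_le h₁
  have h₄ := coheight_add_one_le h₂
  rw [hx] at h₃
  have h₅ : (1 : ℕ∞) ≤ coheight y := le_add_self.trans h₄
  have h₆ : (1 : ℕ∞) + 1 ≤ 1 := (add_le_add_left h₅ 1).trans h₃
  norm_num at h₆

theorem coheight_genericPoint (X : Scheme.{u}) [IrreducibleSpace X] :
    coheight (genericPoint X) = 0 :=
  coheight_eq_zero.mpr fun y _ ↦ genericPoint_specializes y

theorem one_le_coheight {X : Scheme.{u}} [IrreducibleSpace X] {x : X}
    (hx : x ≠ genericPoint X) : 1 ≤ coheight x := by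
  rw [Order.one_le_iff_pos, pos_iff_ne_zero, Ne, coheight_eq_zero]
  intro hmax
  have h₁ : x ⤳ genericPoint X := hmax (genericPoint_specializes x)
  exact hx (h₁.antisymm (genericPoint_specializes x)).eq

theorem coheight_eq_one_of_forall_specializes {X : Scheme.{u}} [IrreducibleSpace X] {x : X}
    (hx : x ≠ genericPoint X) (h : ∀ y, y ⤳ x → y = x ∨ y = genericPoint X) :
    coheight x = 1 := by
  refine le_antisymm ?_ (one_le_coheight hx)
  refine coheight_le_coe_iff (n := 1).mpr fun y hy ↦ ?_
  rcases h y hy.le with rfl | rfl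
  · exact absurd hy (lt_irrefl _)
  · rw [coheight_genericPoint]
    exact zero_lt_one

variable {X B : Scheme.{u}} [IsIntegral B] (π : X ⟶ B)

theorem isVertical_iff {x : X} : IsVertical π x ↔ π x ≠ genericPoint B := by
  have h : closure (π '' closure {x}) = closure {π x} := by
    rw [closure_image_closure π.continuous, Set.image_singleton]
  rw [IsVertical, h, not_iff_not]
  constructor
  · intro h'
    have h₁ : π x ⤳ genericPoint B := by
      rw [specializes_iff_mem_closure, h']; trivial
    exact (h₁.antisymm (genericPoint_specializes _)).eq
  · intro h'
    rw [h', genericPoint_closure]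

/-- A flat morphism maps vertical prime divisors to generic points of prime divisors. -/
theorem coheight_apply_of_flat [IsIntegral X] [Flat π] {x : X} (hx : coheight x = 1)
    (h : π x ≠ genericPoint B) : coheight (π x) = 1 := by
  refine coheight_eq_one_of_forall_specializes h fun b hb ↦ ?_
  -- Going down lifts a generization of `π x` to one of `x`, and `x` has only itself and the generic
  -- point.
  obtain ⟨x', hx', rfl⟩ := Flat.generalizingMap π hb
  rcases eq_or_eq_genericPoint_of_specializes hx hx' with rfl | rfl
  · exact .inl rfl
  · exact .inr (flat_apply_genericPoint π)

/-- Krull's principal ideal theorem for fibres over prime divisors: a point over a prime divisor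
`D` that is the only generization of itself over `D` has codimension one. -/
theorem coheight_eq_one_of_isMax_fiber [IsIntegral X] [IsLocallyNoetherian X] [Flat π] {x : X}
    (h : coheight (π x) = 1) (hmax : ∀ y, y ⤳ x → π y = π x → y = x) : coheight x = 1 := by
  have hx : x ≠ genericPoint X := by
    rintro rfl
    exact ne_genericPoint_of_coheight_eq_one h (flat_apply_genericPoint π)
  have hd : Ring.KrullDimLE 1 (B.presheaf.stalk (π x)) := krullDimLE_of_coheight_le h.le
  have hnf : ¬ IsField (B.presheaf.stalk (π x)) := by
    intro hf
    have := ringKrullDim_stalk_eq_coheight (π x)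
    rw [ringKrullDim_eq_zero_of_isField hf, h] at this
    exact zero_ne_one (α := ℕ∞) (by exact_mod_cast this)
  -- The local ring at `π x` is a one-dimensional domain, so its maximal ideal is the only prime
  -- containing the nonzero nonunit `f`.
  obtain ⟨f, hf, hf0⟩ := Submodule.exists_mem_ne_zero_of_ne_bot
    (IsLocalRing.isField_iff_maximalIdeal_eq.not.mp hnf)
  let φ := (π.stalkMap x).hom
  -- A prime containing the image of `f` is a generization of `x` still lying over `π x`, hence `x`
  -- itself by `hmax`. Krull's theorem then bounds the height by one.
  have hmin : IsLocalRing.maximalIdeal (X.presheaf.stalk x) ∈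
      (Ideal.span {φ f}).minimalPrimes := by
    refine ⟨⟨inferInstance, ?_⟩, ?_⟩
    · rw [Ideal.span_singleton_le_iff_mem]
      exact (mem_nonunits_iff.mpr fun hu ↦ hf (isUnit_of_map_unit φ f hu))
    · rintro q ⟨hq, hfq⟩ -
      let z : Spec (X.presheaf.stalk x) := ⟨q, hq⟩
      have hz : X.fromSpecStalk x z ⤳ x := by
        have : X.fromSpecStalk x z ∈ {y | y ⤳ x} := by
          rw [← Scheme.range_fromSpecStalk]; exact ⟨z, rfl⟩
        exact this
      have hz' : π (X.fromSpecStalk x z) = π x := by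
        rw [← Scheme.Hom.comp_apply, ← Scheme.SpecMap_stalkMap_fromSpecStalk,
          Scheme.Hom.comp_apply]
        have : Spec.map (π.stalkMap x) z = IsLocalRing.closedPoint _ := by
          apply PrimeSpectrum.ext
          have hp : (q.comap φ).IsPrime := hq.comap φ
          exact IsLocalRing.eq_maximalIdeal (hp.isMaximal_of_ne_bot
            (fun h0 ↦ hf0 (by
              have : f ∈ q.comap φ := hfq (Ideal.mem_span_singleton_self _)
              rwa [h0] at this)))
        rw [this, Scheme.fromSpecStalk_closedPoint]
      have h₁ := (hmax _ hz hz').trans Scheme.fromSpecStalk_closedPoint.symm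
      have h₂ := (X.fromSpecStalk x).isEmbedding.injective h₁
      exact (congrArg PrimeSpectrum.asIdeal h₂).ge
  have hle : coheight x ≤ 1 := by
    have h₁ := Ideal.height_le_one_of_isPrincipal_of_mem_minimalPrimes _ _ hmin
    have h₂ := ringKrullDim_stalk_eq_coheight x
    rw [← IsLocalRing.maximalIdeal_height_eq_ringKrullDim] at h₂
    rw [← WithBot.coe_inj.mp h₂]
    exact h₁
  exact le_antisymm hle (one_le_coheight hx)

end Divisors

/-! ### Vanishing of almost all defect terms -/

section Defect

theorem birationalOver_comp {X Y S T : Scheme.{u}} {sX : X ⟶ S} {sY : Y ⟶ S}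
    (h : Scheme.BirationalOver sX sY) (t : S ⟶ T) :
    Scheme.BirationalOver (sX ≫ t) (sY ≫ t) := by
  obtain ⟨f, hf⟩ := h
  exact ⟨f, by simp only [Scheme.PartialIso.IsOver, ← Category.assoc] at hf ⊢; rw [hf]⟩

theorem irreducibleSpace_of_partialIso {X Y : Scheme.{u}} [IrreducibleSpace X]
    (f : X.PartialIso Y) : IrreducibleSpace Y := by
  have : IrreducibleSpace f.source.toScheme := Subtype.irreducibleSpace
    ⟨f.dense_source.nonempty, (PreirreducibleSpace.isPreirreducible_univ (X := X)).open_subset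
      f.source.isOpen (Set.subset_univ _)⟩
  let j : f.source.toScheme ⟶ Y := f.iso.hom ≫ f.target.ι
  have hd : DenseRange j := by
    have := Opens.isDominant_ι f.dense_target
    have hj : IsDominant j := by unfold j; infer_instance
    exact hj.denseRange
  have h₁ : IsIrreducible (Set.range j) := by
    rw [← Set.image_univ]
    exact (IrreducibleSpace.isIrreducible_univ _).image _ j.continuous.continuousOn
  have h₂ := h₁.closure
  rw [hd.closure_range] at h₂
  exact { isPreirreducible_univ := h₂.2, toNonempty := Set.nonempty_iff_univ_nonempty.mpr h₂.1 }

theorem componentsClass_of_irreducibleSpace {Z : Scheme.{u}} [IrreducibleSpace Z]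
    (s : Z ⟶ Spec (.of k)) [IsSeparated s] [LocallyOfFiniteType s] [QuasiCompact s] :
    componentsClass s = pointClass s (genericPoint Z) := by
  let z : {z : Z // coheight z = 0} := ⟨genericPoint Z, coheight_genericPoint Z⟩
  refine finsum_eq_single _ z fun y hy ↦ absurd ?_ hy
  have h : y.1 ⤳ genericPoint Z := coheight_eq_zero.mp y.2 (genericPoint_specializes y.1)
  exact Subtype.ext (h.antisymm (genericPoint_specializes _)).eq

variable {X B : Variety k} (π : X.toScheme ⟶ B.toScheme) [Flat π]

/-- Flatness prevents a prime divisor from being mapped into a smaller closed subset of `D`: its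
image point has codimension at most one. -/
theorem apply_mem_closure_iff {D : PrimeDivisor B} {x : X.toScheme} (hx : coheight x = 1) :
    π x ∈ closure {D.1} ↔ π x = D.1 := by
  refine ⟨fun h ↦ ?_, fun h ↦ h ▸ subset_closure rfl⟩
  have hD : D.1 ⤳ π x := specializes_iff_mem_closure.mpr h
  have hne : π x ≠ genericPoint B.toScheme := fun hη ↦
    ne_genericPoint_of_coheight_eq_one D.2
      ((hη ▸ hD).antisymm (genericPoint_specializes D.1)).eq
  exact ((eq_or_eq_genericPoint_of_specializes (coheight_apply_of_flat π hx hne) hD).resolve_right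
    (ne_genericPoint_of_coheight_eq_one D.2)).symm

/-- The generic point of an irreducible preimage of a prime divisor under a flat morphism. -/
theorem exists_preimage_closure_eq {D : PrimeDivisor B}
    (h : IsIrreducible (π ⁻¹' closure {D.1})) :
    ∃ x : X.toScheme, coheight x = 1 ∧ π x = D.1 ∧ π ⁻¹' closure {D.1} = closure {x} := by
  obtain ⟨x, hx⟩ := QuasiSober.sober h (isClosed_closure.preimage π.continuous)
  have hD : D.1 ⤳ π x := specializes_iff_mem_closure.mpr hx.mem
  have hgen : ∀ y, y ⤳ x → π y = D.1 → y = x := fun y hy hyD ↦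
    (hy.antisymm (hx.specializes (by rw [Set.mem_preimage, hyD]; exact subset_closure rfl))).eq
  -- Going down gives a generization of `x` over `D` itself; it lies in the preimage, whose generic
  -- point is `x`, so it equals `x`.
  obtain ⟨y, hy, hyD⟩ := Flat.generalizingMap π hD
  obtain rfl := hgen y hy hyD
  exact ⟨y, coheight_eq_one_of_isMax_fiber π (hyD ▸ D.2) fun z hz hz' ↦ hgen z hz (hz'.trans hyD),
    hyD, hx.symm⟩

/-- A prime divisor over which the morphism is birationally trivial does not contribute to the
vertical divisorial defect. -/
theorem defectTerm_eq_zero (hπ : π ≫ B.str = X.str) (F : Variety k) (D : PrimeDivisor B)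
    (hirr : IsIrreducible (π ⁻¹' closure {D.1}))
    (hbir : Scheme.BirationalOver
      (reducedι X.toScheme ((Closeds.closure {D.1}).preimage π.continuous) ≫ π)
      (reducedι (pullback D.toVariety.str F.str) ⊤ ≫ pullback.fst D.toVariety.str F.str ≫
        reducedι B.toScheme (.closure {D.1}))) : defectTerm π F D = 0 := by
  obtain ⟨x, hx, hxD, hclos⟩ := exists_preimage_closure_eq π hirr
  have hset : {y : X.toScheme | coheight y = 1 ∧ π y ∈ closure {D.1}} = {x} := by
    ext y
    constructor
    · rintro ⟨hy, hyD⟩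
      have hxy : x ⤳ y := specializes_iff_mem_closure.mpr (hclos ▸ hyD)
      exact ((eq_or_eq_genericPoint_of_specializes hy hxy).resolve_right
        (ne_genericPoint_of_coheight_eq_one hx)).symm
    · rintro rfl
      exact ⟨hx, hxD ▸ subset_closure rfl⟩
  have hZ : (Closeds.closure {D.1}).preimage π.continuous = Closeds.closure {x} :=
    Closeds.ext hclos
  rw [hZ] at hbir
  -- Irreducibility of `D × F` is not assumed: it is inherited from `π⁻¹(D)` through the birational
  -- map, so `[F × D]` is a single class.
  have hP : IrreducibleSpace (pullback D.toVariety.str F.str : Scheme.{u}) := by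
    obtain ⟨f, -⟩ := hbir
    have := irreducibleSpace_of_partialIso f
    have hs : Function.Surjective (reducedι (pullback D.toVariety.str F.str) ⊤) := by
      rw [← Set.range_eq_univ, range_reducedι]; rfl
    exact hs.irreducibleSpace (reducedι (pullback D.toVariety.str F.str) ⊤).continuous
  have htop : (⊤ : Closeds (pullback D.toVariety.str F.str : Scheme.{u})) =
      Closeds.closure {genericPoint (pullback D.toVariety.str F.str : Scheme.{u})} :=
    Closeds.ext (genericPoint_closure _).symm
  rw [htop] at hbir
  -- Birationality over `B` is weakened to birationality over `k`, which is all that the Burnside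
  -- class records.
  have h := birationalOver_comp hbir B.str
  simp only [Category.assoc, hπ] at h
  rw [defectTerm, preimageClass, hset, finsum_mem_singleton, prodClass_comm, prodClass,
    componentsClass_of_irreducibleSpace, sub_eq_zero]
  exact congrArg FreeAbelianGroup.of (Quotient.sound h)

theorem finite_support_defectTerm (hπ : π ≫ B.str = X.str) {F : Variety k}
    (h : IsBirTrivialInCodimOne π F) : (Function.support (defectTerm π F)).Finite :=
  h.subset fun D hD hD' ↦ hD (defectTerm_eq_zero π hπ F D hD'.1 hD'.2)

end Defect

/-- Two sums over sets agree if a one-to-one correspondence between the sets matches their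
summands. -/
theorem finsum_mem_eq_of_rel {α β M : Type*} [AddCommMonoid M] {s : Set α} {t : Set β}
    {f : α → M} {g : β → M} (R : α → β → Prop) (hst : ∀ a ∈ s, ∃ b ∈ t, R a b)
    (hts : ∀ b ∈ t, ∃ a ∈ s, R a b) (hr : ∀ a b b', R a b → R a b' → b = b')
    (hl : ∀ a a' b, R a b → R a' b → a = a') (hfg : ∀ a ∈ s, ∀ b ∈ t, R a b → f a = g b) :
    ∑ᶠ a ∈ s, f a = ∑ᶠ b ∈ t, g b := by
  choose e het heR using hst
  rw [← finsum_set_coe_eq_finsum_mem, ← finsum_set_coe_eq_finsum_mem]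
  refine finsum_eq_of_bijective (fun a : s ↦ (⟨e a.1 a.2, het a.1 a.2⟩ : t)) ⟨?_, ?_⟩ ?_
  · intro a a' h
    have h' : e a.1 a.2 = e a'.1 a'.2 := congrArg Subtype.val h
    exact Subtype.ext (hl _ _ _ (heR a.1 a.2) (h' ▸ heR a'.1 a'.2))
  · rintro ⟨b, hb⟩
    obtain ⟨a, ha, hab⟩ := hts b hb
    exact ⟨⟨a, ha⟩, Subtype.ext (hr _ _ _ (heR a ha) hab)⟩
  · exact fun a ↦ hfg _ a.2 _ (het _ a.2) (heR _ a.2)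

/-! ### Splitting the defect of one morphism -/

section OneMorphism

variable {X B : Variety k} (π : X.toScheme ⟶ B.toScheme)

/-- The generic points of the prime divisors of `X` contained in `π⁻¹(D)`. -/
def divisorsOver (D : PrimeDivisor B) : Set X.toScheme :=
  {x | coheight x = 1 ∧ π x ∈ closure {D.1}}

/-- The summand of the vertical divisorial defect without the contribution of the prime divisors
in `E`. -/
noncomputable def restTerm (F : Variety k) (E : Set X.toScheme) (D : PrimeDivisor B) : Burn k :=
  (∑ᶠ x ∈ divisorsOver π D \ E, pointClass X.str x) - prodClass F D.toVariety

variable [Flat π]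

theorem mem_divisorsOver_iff {D : PrimeDivisor B} {x : X.toScheme} :
    x ∈ divisorsOver π D ↔ coheight x = 1 ∧ π x = D.1 :=
  and_congr_right fun hx ↦ apply_mem_closure_iff π hx

theorem pairwiseDisjoint_divisorsOver (P : Set (PrimeDivisor B)) :
    P.PairwiseDisjoint (divisorsOver π) := by
  intro D _ D' _ hD
  refine Set.disjoint_left.mpr fun x hx hx' ↦ hD (Subtype.ext ?_)
  rw [← ((mem_divisorsOver_iff π).mp hx).2, ((mem_divisorsOver_iff π).mp hx').2]

/-- The vertical divisorial defect, with a finite set `E` of prime divisors of `X` and a finite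
set `P` of prime divisors of `B` treated separately. -/
theorem defect_eq {F : Variety k} (hfin : (Function.support (defectTerm π F)).Finite)
    {E : Set X.toScheme} (hE : E.Finite) (hE₁ : ∀ x ∈ E, coheight x = 1)
    {P : Set (PrimeDivisor B)} (hP : P.Finite) :
    defect π F = (∑ᶠ x ∈ {x ∈ E | IsVertical π x}, pointClass X.str x) +
      (∑ᶠ D ∈ Pᶜ, restTerm π F E D) +
      ((∑ᶠ x ∈ ⋃ D ∈ P, divisorsOver π D \ E, pointClass X.str x) -
        ∑ᶠ D ∈ P, prodClass F D.toVariety) := by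
  let exTerm : PrimeDivisor B → Burn k := fun D ↦
    ∑ᶠ x ∈ divisorsOver π D ∩ E, pointClass X.str x
  have hdt : ∀ D, defectTerm π F D = exTerm D + restTerm π F E D := fun D ↦ by
    rw [defectTerm, restTerm, ← add_sub_assoc, preimageClass]
    congr 1
    exact (finsum_mem_inter_add_sdiff E (finite_preimage π D)).symm
  -- Only the finitely many `D` under a point of `E` contribute to `exTerm`. Finite supports matter,
  -- since a `finsum` with infinite support is zero by convention.
  let T : Set (PrimeDivisor B) := {D | D.1 ∈ π '' E}
  have hT : T.Finite := (hE.image π).preimage Subtype.val_injective.injOn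
  have hexT : Function.support exTerm ⊆ T := by
    intro D hD
    by_contra hDT
    refine hD ?_
    have : divisorsOver π D ∩ E = ∅ := Set.eq_empty_of_forall_notMem fun x hx ↦
      hDT ⟨x, hx.2, ((mem_divisorsOver_iff π).mp hx.1).2⟩
    simp only [exTerm, this, finsum_mem_empty]
  have hex : (Function.support exTerm).Finite := hT.subset hexT
  have hrest : (Function.support (restTerm π F E)).Finite := by
    refine (hfin.union hex).subset fun D hD ↦ ?_
    by_contra h
    simp only [Set.mem_union, Function.mem_support, not_or, not_not] at h
    have := hdt D
    rw [h.1, h.2, zero_add] at this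
    exact hD this.symm
  have hsum_ex : ∑ᶠ D, exTerm D = ∑ᶠ x ∈ {x ∈ E | IsVertical π x}, pointClass X.str x := by
    -- Each vertical point of `E` lies over one `D` by flatness; those dominating `B` lie over none
    -- and drop out.
    have hU : {x ∈ E | IsVertical π x} = ⋃ D ∈ T, divisorsOver π D ∩ E := by
      ext x
      simp only [Set.mem_iUnion, exists_prop]
      constructor
      · rintro ⟨hx, hv⟩
        refine ⟨⟨π x, coheight_apply_of_flat π (hE₁ x hx) ((isVertical_iff π).mp hv)⟩,
          ⟨x, hx, rfl⟩, (mem_divisorsOver_iff π).mpr ⟨hE₁ x hx, rfl⟩, hx⟩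
      · rintro ⟨D, -, hx, hxE⟩
        refine ⟨hxE, (isVertical_iff π).mpr ?_⟩
        rw [((mem_divisorsOver_iff π).mp hx).2]
        exact ne_genericPoint_of_coheight_eq_one D.2
    rw [hU, finsum_mem_biUnion ((pairwiseDisjoint_divisorsOver π T).mono
      fun D ↦ Set.inter_subset_left) hT fun D _ ↦ hE.inter_of_right _, ← finsum_mem_univ]
    exact finsum_mem_inter_support_eq' _ _ _ fun D hD ↦ ⟨fun _ ↦ hexT hD, fun _ ↦ trivial⟩
  have hsum_rest : ∑ᶠ D, restTerm π F E D =
      ∑ᶠ D ∈ P, restTerm π F E D + ∑ᶠ D ∈ Pᶜ, restTerm π F E D := by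
    rw [← finsum_mem_univ, ← Set.union_compl_self P]
    exact finsum_mem_union' disjoint_compl_right (hP.inter_of_left _) (hrest.inter_of_right _)
  have hsum_P : ∑ᶠ D ∈ P, restTerm π F E D =
      (∑ᶠ x ∈ ⋃ D ∈ P, divisorsOver π D \ E, pointClass X.str x) -
        ∑ᶠ D ∈ P, prodClass F D.toVariety := by
    rw [finsum_mem_biUnion ((pairwiseDisjoint_divisorsOver π P).mono
      fun D ↦ Set.sdiff_subset) hP fun D _ ↦ (finite_preimage π D).sdiff,
      ← finsum_mem_sub_distrib _ _ hP]
    rfl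
  rw [defect, finsum_congr hdt, finsum_add_distrib hex hrest, hsum_ex, hsum_rest, hsum_P]
  abel

end OneMorphism

/-! ### Multiplication by the class of the fiber -/

theorem finite_primeDivisor_mem {B : Variety k} {E : Set B.toScheme} (hE : E.Finite) :
    {D : PrimeDivisor B | D.1 ∈ E}.Finite :=
  hE.preimage Subtype.val_injective.injOn

theorem finsum_pointClass_mul_cls {B : Variety k} (F : Variety k) {E : Set B.toScheme}
    (hE : E.Finite) (hE₁ : ∀ x ∈ E, coheight x = 1) :
    (Burn.mulHom k).flip (Burn.cls F) (∑ᶠ b ∈ E, pointClass B.str b) =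
      ∑ᶠ D ∈ {D : PrimeDivisor B | D.1 ∈ E}, prodClass F D.toVariety := by
  rw [AddMonoidHom.map_finsum_mem _ _ hE]
  refine (finsum_mem_eq_of_bijOn Subtype.val ⟨fun _ hD ↦ hD, Subtype.val_injective.injOn,
    fun b hb ↦ ⟨⟨b, hE₁ b hb⟩, hb, rfl⟩⟩ fun (D : PrimeDivisor B) _ ↦ ?_).symm
  rw [prodClass_comm]
  exact (Burn.cls_mul_cls (PrimeDivisor.toVariety D) F).symm

theorem BirMap.c_mul_cls {B₁ B₂ : Variety k} (σ : BirMap B₁ B₂) (F : Variety k) :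
    σ.c * Burn.cls F =
      (∑ᶠ D ∈ {D : PrimeDivisor B₂ | D.1 ∈ σ.symm.exDiv}, prodClass F D.toVariety) -
        ∑ᶠ D ∈ {D : PrimeDivisor B₁ | D.1 ∈ σ.exDiv}, prodClass F D.toVariety := by
  rw [← finsum_pointClass_mul_cls F σ.finite_exDiv fun _ h ↦ h.1,
    ← finsum_pointClass_mul_cls F σ.symm.finite_exDiv fun _ h ↦ h.1, ← map_sub]
  rfl

/-! ### Matching divisors across the square -/

namespace BirSquare

variable {X₁ B₁ X₂ B₂ : Variety k} {π₁ : X₁.toScheme ⟶ B₁.toScheme}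
  {π₂ : X₂.toScheme ⟶ B₂.toScheme} [Flat π₁] [Flat π₂] (φ : BirSquare π₁ π₂)

theorem exists_corresponds_over {D : PrimeDivisor B₁} {D' : PrimeDivisor B₂}
    (hD : φ.base.Corresponds D.1 D'.1) {x : X₁.toScheme}
    (hx : x ∈ divisorsOver π₁ D \ φ.total.exDiv) :
    ∃ y ∈ divisorsOver π₂ D' \ φ.total.symm.exDiv, φ.total.Corresponds x y := by
  obtain ⟨hx₁, hxD⟩ := (mem_divisorsOver_iff π₁).mp hx.1
  obtain ⟨y, hy⟩ := (BirMap.notMem_exDiv_iff hx₁).mp hx.2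
  refine ⟨y, ⟨(mem_divisorsOver_iff π₂).mpr ⟨hy.coheight_eq.symm.trans hx₁, ?_⟩,
    hy.symm.notMem_exDiv⟩, hy⟩
  exact φ.apply_eq_of_corresponds hy (hxD.symm ▸ hD)

/-- The non-exceptional prime divisors over exceptional divisors of the base correspond to
non-exceptional prime divisors over exceptional divisors of the base. -/
theorem exists_corresponds_over_exDiv {x : X₁.toScheme}
    (hx : x ∈ ⋃ D ∈ {D : PrimeDivisor B₁ | D.1 ∈ φ.base.exDiv},
      divisorsOver π₁ D \ φ.total.exDiv) :
    ∃ y ∈ ⋃ D ∈ {D : PrimeDivisor B₂ | D.1 ∈ φ.base.symm.exDiv},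
      divisorsOver π₂ D \ φ.total.symm.exDiv, φ.total.Corresponds x y := by
  simp only [Set.mem_iUnion, exists_prop] at hx ⊢
  obtain ⟨D, hD, hxD, hxE⟩ := hx
  obtain ⟨hx₁, hxD⟩ := (mem_divisorsOver_iff π₁).mp hxD
  obtain ⟨y, hy⟩ := (BirMap.notMem_exDiv_iff hx₁).mp hxE
  have hy₁ : coheight y = 1 := hy.coheight_eq.symm.trans hx₁
  -- Nothing can be said through `σ` at `D`, where it is exceptional; the inverse square is used at
  -- `π₂ y` instead.
  have hback : ∀ b, φ.base.symm.Corresponds (π₂ y) b → π₁ x = b := fun b hb ↦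
    φ.symm.apply_eq_of_corresponds hy.symm hb
  -- If `y` dominated `B₂`, then `x` would dominate `B₁`, as `σ⁻¹` matches the generic points.
  have hne : π₂ y ≠ genericPoint B₂.toScheme := fun h ↦
    ne_genericPoint_of_coheight_eq_one D.2
      (hxD.symm.trans (hback _ (h ▸ φ.base.symm.corresponds_genericPoint)))
  have hD'₁ := coheight_apply_of_flat π₂ hy₁ hne
  refine ⟨y, ⟨⟨π₂ y, hD'₁⟩, ?_, (mem_divisorsOver_iff π₂).mpr ⟨hy₁, rfl⟩,
    hy.symm.notMem_exDiv⟩, hy⟩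
  -- Were `σ⁻¹` a local isomorphism at `π₂ y`, it would match this point with `D`, making `σ` a
  -- local isomorphism at `D`.
  by_contra hD'
  obtain ⟨b, hb⟩ := (BirMap.notMem_exDiv_iff hD'₁).mp hD'
  obtain rfl := (hback b hb).symm.trans hxD
  exact hb.symm.notMem_exDiv hD

/-- Only the unions are matched: `σ` gives no pairing of its exceptional divisors with those of
`σ⁻¹`. -/
theorem finsum_over_exDiv_eq :
    ∑ᶠ x ∈ ⋃ D ∈ {D : PrimeDivisor B₁ | D.1 ∈ φ.base.exDiv},
      divisorsOver π₁ D \ φ.total.exDiv, pointClass X₁.str x =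
    ∑ᶠ y ∈ ⋃ D ∈ {D : PrimeDivisor B₂ | D.1 ∈ φ.base.symm.exDiv},
      divisorsOver π₂ D \ φ.total.symm.exDiv, pointClass X₂.str y := by
  refine finsum_mem_eq_of_rel φ.total.Corresponds (fun x hx ↦ φ.exists_corresponds_over_exDiv hx)
    (fun y hy ↦ ?_) (fun _ _ _ h h' ↦ h.right_unique h') (fun _ _ _ h h' ↦ h.left_unique h')
    fun _ _ _ _ h ↦ h.pointClass_eq
  obtain ⟨x, hx, hxy⟩ := φ.symm.exists_corresponds_over_exDiv hy
  exact ⟨x, hx, hxy.symm⟩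

/-- Both parts agree: `D` and `D'` are birational, hence so are their contributions with `F`, and
`φ` matches the non-exceptional divisors above them. -/
theorem restTerm_eq_of_corresponds (F : Variety k) {D : PrimeDivisor B₁} {D' : PrimeDivisor B₂}
    (hD : φ.base.Corresponds D.1 D'.1) :
    restTerm π₁ F φ.total.exDiv D = restTerm π₂ F φ.total.symm.exDiv D' := by
  have h : prodClass F D.toVariety = prodClass F D'.toVariety := by
    rw [prodClass_comm F, prodClass_comm F]
    exact prodClass_left_congr D.toVariety D'.toVariety F hD.birational
  rw [restTerm, restTerm, h]
  congr 1
  refine finsum_mem_eq_of_rel φ.total.Corresponds (fun x hx ↦ φ.exists_corresponds_over hD hx)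
    (fun y hy ↦ ?_) (fun _ _ _ h h' ↦ h.right_unique h') (fun _ _ _ h h' ↦ h.left_unique h')
    fun _ _ _ _ h ↦ h.pointClass_eq
  obtain ⟨x, hx, hxy⟩ := φ.symm.exists_corresponds_over hD.symm hy
  exact ⟨x, hx, hxy.symm⟩

theorem exists_primeDivisor_corresponds {Y Z : Variety k} (σ : BirMap Y Z) {D : PrimeDivisor Y}
    (hD : D ∈ {D : PrimeDivisor Y | D.1 ∈ σ.exDiv}ᶜ) :
    ∃ D' ∈ {D' : PrimeDivisor Z | D'.1 ∈ σ.symm.exDiv}ᶜ, σ.Corresponds D.1 D'.1 := by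
  obtain ⟨b, hb⟩ := (BirMap.notMem_exDiv_iff D.2).mp hD
  exact ⟨⟨b, hb.coheight_eq.symm.trans D.2⟩, hb.symm.notMem_exDiv, hb⟩

theorem finsum_restTerm_eq (F : Variety k) :
    ∑ᶠ D ∈ {D : PrimeDivisor B₁ | D.1 ∈ φ.base.exDiv}ᶜ, restTerm π₁ F φ.total.exDiv D =
      ∑ᶠ D ∈ {D : PrimeDivisor B₂ | D.1 ∈ φ.base.symm.exDiv}ᶜ,
        restTerm π₂ F φ.total.symm.exDiv D := by
  refine finsum_mem_eq_of_rel (fun D D' ↦ φ.base.Corresponds D.1 D'.1)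
    (fun D hD ↦ exists_primeDivisor_corresponds φ.base hD) (fun D' hD' ↦ ?_)
    (fun _ _ _ h h' ↦ Subtype.ext (h.right_unique h'))
    (fun _ _ _ h h' ↦ Subtype.ext (h.left_unique h'))
    fun _ _ _ _ h ↦ φ.restTerm_eq_of_corresponds F h
  obtain ⟨D, hD, h⟩ := exists_primeDivisor_corresponds φ.base.symm hD'
  exact ⟨D, hD, h.symm⟩

end BirSquare

end BirInv

theorem mainTheorem7 {k : Type u} [Field k] (X₁ B₁ X₂ B₂ F : Variety k)
    (π₁ : X₁.toScheme ⟶ B₁.toScheme) (π₂ : X₂.toScheme ⟶ B₂.toScheme)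
    (hπ₁ : π₁ ≫ B₁.str = X₁.str) (hπ₂ : π₂ ≫ B₂.str = X₂.str)
    (hX₁ : IsNormalScheme X₁.toScheme) (hB₁ : IsNormalScheme B₁.toScheme)
    (hX₂ : IsNormalScheme X₂.toScheme) (hB₂ : IsNormalScheme B₂.toScheme)
    [Flat π₁] [Flat π₂]
    (h₁ : IsBirTrivialInCodimOne π₁ F) (h₂ : IsBirTrivialInCodimOne π₂ F)
    (φ : BirSquare π₁ π₂) :
    (Function.support (defectTerm π₁ F)).Finite ∧ (Function.support (defectTerm π₂ F)).Finite ∧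
      φ.cVer = defect π₂ F - defect π₁ F + φ.base.c * Burn.cls F := by
  have hf₁ := finite_support_defectTerm π₁ hπ₁ h₁
  have hf₂ := finite_support_defectTerm π₂ hπ₂ h₂
  refine ⟨hf₁, hf₂, ?_⟩
  -- With the exceptional sets of `φ`, `σ` and their inverses as `E` and `P`, the matched sums
  -- become identical and cancel in the difference.
  rw [defect_eq π₁ hf₁ φ.total.finite_exDiv (fun _ h ↦ h.1)
      (finite_primeDivisor_mem φ.base.finite_exDiv),
    defect_eq π₂ hf₂ φ.total.symm.finite_exDiv (fun _ h ↦ h.1)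
      (finite_primeDivisor_mem φ.base.symm.finite_exDiv),
    φ.finsum_over_exDiv_eq, φ.finsum_restTerm_eq F, φ.base.c_mul_cls F, BirSquare.cVer]
  abel
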